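/- Fix $\zeta>1$ and let $f(x)=L_\zeta^{-1}e^{-|x|^\zeta/\zeta}$, $x\in\mathbb{R}$, be the Subbotin density, where $L_\zeta=\int_{\mathbb{R}}e^{-|x|^\zeta/\zeta}\,dx$; let $F$ be its cumulative distribution function and $\overline F=1-F$. For $\theta\in\mathbb{R}^n$ let $P_\theta$ be the law of $X=(X_1,\dots,X_n)$, $X_i=\theta_i+\varepsilon_i$, with $\varepsilon_1,\dots,\varepsilon_n$ i.i.d. with density $f$, and let $E_\theta$ be the corresponding expectation. A multiple testing procedure is a measurable map $\varphi=(\varphi_i)_{1\le i\le n}:\mathbb{R}^n\to\{0,1\}^n$, and its combined risk at $\theta$ is \[ \mathfrak{R}(\theta,\varphi)=E_\theta\left[\frac{\sum_{i=1}^n \mathbf{1}\{\theta_i=0\}\varphi_i(X)}{\max\big(1,\sum_{i=1}^n\varphi_i(X)\big)}\right]+E_\theta\left[\frac{\sum_{i=1}^n \mathbf{1}\{\theta_i\ne0\}(1-\varphi_i(X))}{\max\big(1,\sum_{i=1}^n\mathbf{1}\{\theta_i\neq0\}\big)}\right] \] (the false discovery rate plus the false negative rate). Let $(s_n)_{n\ge1}$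 be a sequence of nonnegative integers such that $s_n\to\infty$ and $n/s_n\to\infty$ as $n\to\infty$. For each $n$ let $\bm b=\bm b^{(n)}=(b_j)_{1\le j\le s_n}\in\mathbb{R}^{s_n}$ (possibly varying with $n$) be such that, for all sufficiently large $n$, $b_j>-(\zeta\log(n/s_n))^{1/\zeta}$ for all $1\le j\le s_n$. Assume that the limit \[ \Lambda_\infty=\lim_{n\to\infty}\frac1{s_n}\sum_{j=1}^{s_n}\overline F(b_j) \] exists (it then lies in $[0,1]$). Let $\Theta_{\bm b}$ be the set of $\theta\in\mathbb{R}^n$ with at most $s_n$ nonzero coordinates for which there are distinct indices $i_1,\dots,i_{s_n}\in\{1,\dots,n\}$ with $|\theta_{i_j}|\ge(\zeta\log(n/s_n))^{1/\zeta}+b_j$ for all $1\le j\le s_n$. Then, as $n\to\infty$, \[ \inf_{\varphi}\ \sup_{\theta\in\Theta_{\bm b}}\mathfrak{R}(\theta,\varphi)=\Lambda_\infty+o(1), \] where the infimum is over all multiple testing procedures. -/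

import Mathlib

open MeasureTheory ProbabilityTheory Filter Topology

noncomputable section

namespace SparseTesting

/-- The normalising constant `L_ζ` of the Subbotin density. -/
def subbotinConst (ζ : ℝ) : ℝ := ∫ x : ℝ, Real.exp (-(|x| ^ ζ / ζ))

/-- The Subbotin density `f_ζ(x) = L_ζ⁻¹ exp (-|x|^ζ / ζ)`. -/
def subbotinPDF (ζ : ℝ) (x : ℝ) : ℝ := (subbotinConst ζ)⁻¹ * Real.exp (-(|x| ^ ζ / ζ))

/-- The Subbotin distribution on `ℝ`. -/
def subbotin (ζ : ℝ) : Measure ℝ := volume.withDensity fun x => ENNReal.ofReal (subbotinPDF ζ x)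

/-- The upper tail `1 - F_ζ` of the Subbotin distribution. -/
def tail (ζ : ℝ) (x : ℝ) : ℝ := 1 - cdf (subbotin ζ) x

/-- The law `P_θ` of `X = θ + ε`, where `ε` has i.i.d. Subbotin coordinates. -/
def law (ζ : ℝ) {n : ℕ} (θ : Fin n → ℝ) : Measure (Fin n → ℝ) :=
  (Measure.pi fun _ : Fin n => subbotin ζ).map fun ε i => θ i + ε i

/-- A (nonrandomised) multiple testing procedure: a measurable map `ℝⁿ → {0,1}ⁿ`. -/
def Procedure (n : ℕ) : Type :=
  {φ : (Fin n → ℝ) → (Fin n → Bool) // Measurable φ}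

/-- `φ_i(x)` as a real number: `1` if the `i`-th null hypothesis is rejected, `0` otherwise. -/
def Procedure.rej {n : ℕ} (φ : Procedure n) (x : Fin n → ℝ) (i : Fin n) : ℝ :=
  if φ.1 x i = true then 1 else 0

/-- The false discovery proportion. -/
def FDP {n : ℕ} (θ : Fin n → ℝ) (φ : Procedure n) (x : Fin n → ℝ) : ℝ :=
  (∑ i, if θ i = 0 then φ.rej x i else 0) / max 1 (∑ i, φ.rej x i)

/-- The proportion of signals that are missed. -/
def FNP {n : ℕ} (θ : Fin n → ℝ) (φ : Procedure n) (x : Fin n → ℝ) : ℝ :=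
  (∑ i, if θ i ≠ 0 then 1 - φ.rej x i else 0) / max 1 (∑ i, if θ i ≠ 0 then (1 : ℝ) else 0)

/-- The false discovery rate. -/
def FDR (ζ : ℝ) {n : ℕ} (θ : Fin n → ℝ) (φ : Procedure n) : ℝ := ∫ x, FDP θ φ x ∂(law ζ θ)

/-- The false negative rate. -/
def FNR (ζ : ℝ) {n : ℕ} (θ : Fin n → ℝ) (φ : Procedure n) : ℝ := ∫ x, FNP θ φ x ∂(law ζ θ)

/-- The combined multiple testing risk. -/
def risk (ζ : ℝ) {n : ℕ} (θ : Fin n → ℝ) (φ : Procedure n) : ℝ := FDR ζ θ φ + FNR ζ θ φ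

/-- The minimax risk over `Θ`. As `0 ≤ risk ≤ 2` for `ζ > 1`, the real supremum and infimum
are the true ones whenever `Θ` is nonempty. -/
def minimaxRisk (ζ : ℝ) {n : ℕ} (Θ : Set (Fin n → ℝ)) : ℝ :=
  ⨅ φ : Procedure n, ⨆ θ : Θ, risk ζ θ.1 φ

/-- The vectors with at most `s` nonzero coordinates. -/
def ellZero (n s : ℕ) : Set (Fin n → ℝ) := {θ | {i | θ i ≠ 0}.ncard ≤ s}

/-- The oracle threshold `(ζ log (n / s))^{1/ζ}`. -/
def oracleThreshold (ζ : ℝ) (n s : ℕ) : ℝ := (ζ * Real.log ((n : ℝ) / (s : ℝ))) ^ (1 / ζ)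

/-- The class `Θ_b` of sparse signals with strengths prescribed by `b`. -/
def signalClass (ζ : ℝ) (n : ℕ) {s : ℕ} (b : Fin s → ℝ) : Set (Fin n → ℝ) :=
  {θ | θ ∈ ellZero n s ∧
    ∃ i : Fin s → Fin n, Function.Injective i ∧ ∀ j, oracleThreshold ζ n s + b j ≤ |θ (i j)|}

/-- `Λ_n(b)`, the average of the tail probabilities `1 - F_ζ(b_j)`. -/
def avgTail (ζ : ℝ) {s : ℕ} (b : Fin s → ℝ) : ℝ := (1 / (s : ℝ)) * ∑ j, tail ζ (b j)

end SparseTesting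

end

noncomputable section

namespace SparseTesting

/-! ### The Subbotin law: tails, shifts, truncated likelihood ratios. -/

section Subbotin

variable {ζ : ℝ}

/-! Write a for the oracle threshold, so that e^{a^ζ/ζ} = n/s.

Upper bound: reject when |X_i| ≥ a. A signal of strength a + b_j is missed with probability at most
`tail ζ (b j)`, so the FNR is at most `avgTail`. About (n/s)·`tail ζ a` false rejections per signal
are expected, which tends to 0 because ζ > 1 (`tail_le`). If Λ < 1, true rejections concentrate at
order s and the FDR vanishes (`risk_thresholdProcedure_le`); if Λ ≥ 1, never rejecting suffices.

Lower bound: put one signal of size a + b_j at a uniform position in each of s disjoint blocks of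
length about n/s. The risk dominates a weighted Hamming loss (`FDP_add_FNP_ge`), which splits over
blocks. In one block (`block_risk_ge`), a change of measure to the null weights positions by
likelihood ratios truncated at T = a - δ. These are bounded by e^{T^ζ/ζ} = o(n/s), so their sum
concentrates: rejecting any position costs at least as much as missing it. What remains is the
truncated mass, nearly `tail ζ (b j + δ)`. Finally let δ and the weight c be small. -/

lemma integrable_exp_neg_abs_rpow (hζ : 0 < ζ) :
    Integrable fun x : ℝ => Real.exp (-(|x| ^ ζ / ζ)) := by
  have h := integrableOn_rpow_mul_exp_neg_mul_rpow (s := 0) (p := ζ) (b := ζ⁻¹)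
    (by norm_num) hζ (by positivity)
  have h2 : IntegrableOn (fun x : ℝ => Real.exp (-(x ^ ζ / ζ))) (Set.Ioi 0) := by
    refine h.congr_fun (fun x _ => ?_) measurableSet_Ioi
    simp only [Real.rpow_zero, one_mul]
    congr 1
    ring
  -- The Bochner integral of a non-integrable function is 0, so a nonzero value proves
  -- integrability.
  refine .of_integral_ne_zero ?_
  rw [integral_comp_abs (f := fun x => Real.exp (-(x ^ ζ / ζ)))]
  have : 0 < ∫ x in Set.Ioi (0 : ℝ), Real.exp (-(x ^ ζ / ζ)) := by
    have : NeZero (volume.restrict (Set.Ioi (0 : ℝ))) := ⟨by simp⟩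
    exact integral_exp_pos h2
  positivity

lemma subbotinConst_pos (hζ : 0 < ζ) : 0 < subbotinConst ζ :=
  integral_exp_pos (integrable_exp_neg_abs_rpow hζ)

lemma measurable_subbotinPDF : Measurable (subbotinPDF ζ) := by
  unfold subbotinPDF
  fun_prop

lemma subbotinPDF_pos (hζ : 0 < ζ) (x : ℝ) : 0 < subbotinPDF ζ x :=
  mul_pos (inv_pos.2 (subbotinConst_pos hζ)) (Real.exp_pos _)

lemma subbotinPDF_neg (x : ℝ) : subbotinPDF ζ (-x) = subbotinPDF ζ x := by
  simp [subbotinPDF]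

lemma subbotinPDF_le (hζ : 0 < ζ) (x : ℝ) : subbotinPDF ζ x ≤ (subbotinConst ζ)⁻¹ := by
  have h := inv_pos.2 (subbotinConst_pos hζ)
  refine mul_le_of_le_one_right h.le (Real.exp_le_one_iff.2 ?_)
  have : 0 ≤ |x| ^ ζ / ζ := by positivity
  linarith

lemma integrable_subbotinPDF (hζ : 0 < ζ) : Integrable (subbotinPDF ζ) :=
  (integrable_exp_neg_abs_rpow hζ).const_mul _

lemma integral_subbotinPDF (hζ : 0 < ζ) : ∫ x, subbotinPDF ζ x = 1 := by
  unfold subbotinPDF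
  rw [integral_const_mul]
  exact inv_mul_cancel₀ (subbotinConst_pos hζ).ne'

lemma isProbabilityMeasure_subbotin (hζ : 0 < ζ) : IsProbabilityMeasure (subbotin ζ) := by
  refine ⟨?_⟩
  rw [subbotin, withDensity_apply _ MeasurableSet.univ, setLIntegral_univ,
    ← ofReal_integral_eq_lintegral_ofReal (integrable_subbotinPDF hζ)
      (ae_of_all _ fun x => (subbotinPDF_pos hζ x).le), integral_subbotinPDF hζ, ENNReal.ofReal_one]

instance : NullSingletonClass (subbotin ζ) :=
  ⟨fun x => withDensity_absolutelyContinuous _ _ (measure_singleton x)⟩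

lemma subbotin_real_apply (hζ : 0 < ζ) {A : Set ℝ} (hA : MeasurableSet A) :
    (subbotin ζ).real A = ∫ x in A, subbotinPDF ζ x := by
  rw [measureReal_def, subbotin, withDensity_apply _ hA,
    ← ofReal_integral_eq_lintegral_ofReal (integrable_subbotinPDF hζ).integrableOn
      (ae_of_all _ fun x => (subbotinPDF_pos hζ x).le), ENNReal.toReal_ofReal]
  exact integral_nonneg fun x => (subbotinPDF_pos hζ x).le

lemma tail_eq (hζ : 0 < ζ) (x : ℝ) : tail ζ x = (subbotin ζ).real (Set.Ioi x) := by
  have := isProbabilityMeasure_subbotin hζ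
  rw [tail, cdf_eq_real, ← probReal_compl_eq_one_sub measurableSet_Iic, Set.compl_Iic]

lemma tail_eq_Ici (hζ : 0 < ζ) (x : ℝ) : tail ζ x = (subbotin ζ).real (Set.Ici x) := by
  rw [tail_eq hζ, measureReal_congr Ioi_ae_eq_Ici]

lemma tail_eq_Iic (hζ : 0 < ζ) (x : ℝ) : tail ζ x = (subbotin ζ).real (Set.Iic (-x)) := by
  rw [tail_eq hζ, subbotin_real_apply hζ measurableSet_Ioi, subbotin_real_apply hζ measurableSet_Iic]
  simpa [subbotinPDF_neg] using (integral_comp_neg_Iic (-x) (subbotinPDF ζ)).symm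

lemma tail_nonneg (x : ℝ) : 0 ≤ tail ζ x := sub_nonneg.2 (cdf_le_one _ _)

lemma tendsto_tail : Tendsto (tail ζ) atTop (𝓝 0) := by
  have h := (tendsto_cdf_atTop (subbotin ζ)).const_sub 1
  rwa [sub_self] at h

/-- The density is bounded, so the loss is uniform in x, hence in all the b_j at once. -/
lemma tail_sub_le_tail_add (hζ : 0 < ζ) (x : ℝ) {δ : ℝ} (hδ : 0 ≤ δ) :
    tail ζ x - δ * (subbotinConst ζ)⁻¹ ≤ tail ζ (x + δ) := by
  have := isProbabilityMeasure_subbotin hζ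
  have h : (subbotin ζ).real (Set.Ioc x (x + δ)) ≤ δ * (subbotinConst ζ)⁻¹ := by
    rw [subbotin_real_apply hζ measurableSet_Ioc]
    calc _ ≤ ∫ _ in Set.Ioc x (x + δ), (subbotinConst ζ)⁻¹ :=
          setIntegral_mono (integrable_subbotinPDF hζ).integrableOn
            (integrableOn_const (by simp)) fun y => subbotinPDF_le hζ y
      _ = _ := by simp [hδ]
  rw [tail_eq hζ, tail_eq hζ, ← Set.Ioc_union_Ioi_eq_Ioi (le_add_of_nonneg_right hδ : x ≤ x + δ)]
  have := measureReal_union_le (μ := subbotin ζ) (Set.Ioc x (x + δ)) (Set.Ioi (x + δ))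
  linarith

lemma rpow_self_eq {x : ℝ} (hx : 0 < x) : x ^ ζ = x * x ^ (ζ - 1) := by
  rw [Real.rpow_sub_one hx.ne', mul_div_cancel₀ _ hx.ne']

/-- Beyond a, x^ζ ≥ a^{ζ-1} x, so the density is dominated by an exponential of rate a^{ζ-1}/ζ that
agrees with it at a. -/
lemma tail_le (hζ : 1 < ζ) {a : ℝ} (ha : 0 < a) :
    tail ζ a ≤ (subbotinConst ζ)⁻¹ * Real.exp (-(a ^ ζ / ζ)) * (ζ / a ^ (ζ - 1)) := by
  have h0 : 0 < ζ := by linarith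
  have hc : 0 < a ^ (ζ - 1) / ζ := by positivity
  set c := a ^ (ζ - 1) / ζ with hc_def
  have hi : IntegrableOn (fun x => (subbotinConst ζ)⁻¹ * Real.exp (-c * x)) (Set.Ioi a) :=
    (integrableOn_exp_mul_Ioi (neg_lt_zero.2 hc) a).const_mul _
  rw [tail_eq h0, subbotin_real_apply h0 measurableSet_Ioi]
  calc _ ≤ ∫ x in Set.Ioi a, (subbotinConst ζ)⁻¹ * Real.exp (-c * x) := by
        refine setIntegral_mono_on (integrable_subbotinPDF h0).integrableOn hi measurableSet_Ioi
          fun x hx => ?_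
        have hx' : 0 < x := ha.trans hx
        refine mul_le_mul_of_nonneg_left (Real.exp_le_exp.2 ?_)
          (inv_pos.2 (subbotinConst_pos h0)).le
        rw [abs_of_pos hx', neg_mul, neg_le_neg_iff, hc_def, div_mul_eq_mul_div,
          rpow_self_eq hx', mul_comm]
        have : a ^ (ζ - 1) ≤ x ^ (ζ - 1) :=
          Real.rpow_le_rpow ha.le (le_of_lt hx) (by linarith)
        gcongr
    _ = _ := by
        rw [integral_const_mul, integral_exp_mul_Ioi (neg_lt_zero.2 hc), rpow_self_eq ha, mul_assoc]
        have : -c * a = -(a * a ^ (ζ - 1) / ζ) := by rw [hc_def]; ring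
        rw [this, hc_def]
        field_simp

/-- Translates of the Subbotin law. -/
def shifted (ζ θ : ℝ) : Measure ℝ := (subbotin ζ).map (θ + ·)

lemma isProbabilityMeasure_shifted (hζ : 0 < ζ) (θ : ℝ) : IsProbabilityMeasure (shifted ζ θ) :=
  have := isProbabilityMeasure_subbotin hζ
  Measure.isProbabilityMeasure_map (by fun_prop)

lemma shifted_zero : shifted ζ 0 = subbotin ζ := by simp [shifted]

lemma shifted_eq_withDensity (hζ : 0 < ζ) (v : ℝ) :
    shifted ζ v = (subbotin ζ).withDensity
      fun x => ENNReal.ofReal (subbotinPDF ζ (x - v) / subbotinPDF ζ x) := by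
  have hm := measurable_subbotinPDF (ζ := ζ)
  rw [subbotin, ← withDensity_mul _ (by fun_prop) (by fun_prop)]
  ext A hA
  rw [shifted, Measure.map_apply (by fun_prop) hA, subbotin,
    withDensity_apply _ (hA.preimage (by fun_prop)), withDensity_apply _ hA,
    ← lintegral_indicator (hA.preimage (by fun_prop)), ← lintegral_indicator hA,
    ← lintegral_sub_right_eq_self _ v]
  congr 1 with x
  by_cases hx : x ∈ A <;> simp [Set.indicator, hx, ← ENNReal.ofReal_mul (subbotinPDF_pos hζ x).le,
    mul_div_cancel₀ _ (subbotinPDF_pos hζ x).ne']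

/-- The likelihood ratio of a shift by `v`, restricted to `|x| ≤ T`. -/
def truncRatio (ζ v T x : ℝ) : ℝ :=
  if |x| ≤ T then subbotinPDF ζ (x - v) / subbotinPDF ζ x else 0

lemma measurable_truncRatio (v T : ℝ) : Measurable (truncRatio ζ v T) := by
  have hm := measurable_subbotinPDF (ζ := ζ)
  exact Measurable.ite (measurableSet_le (by fun_prop) (by fun_prop)) (by fun_prop) (by fun_prop)

lemma truncRatio_nonneg (hζ : 0 < ζ) (v T x : ℝ) : 0 ≤ truncRatio ζ v T x := by
  unfold truncRatio
  split_ifs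
  · exact (div_pos (subbotinPDF_pos hζ _) (subbotinPDF_pos hζ _)).le
  · rfl

/-- The numerator is at most the maximal density and the denominator is smallest at |x| = T; the
bound does not depend on v. -/
lemma truncRatio_le (hζ : 0 < ζ) (v T x : ℝ) : truncRatio ζ v T x ≤ Real.exp (T ^ ζ / ζ) := by
  unfold truncRatio
  split_ifs with h
  · have h1 : subbotinPDF ζ (x - v) / subbotinPDF ζ x
        ≤ (subbotinConst ζ)⁻¹ / subbotinPDF ζ x :=
      div_le_div_of_nonneg_right (subbotinPDF_le hζ _) (subbotinPDF_pos hζ _).le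
    have h2 : (subbotinConst ζ)⁻¹ / subbotinPDF ζ x = Real.exp (|x| ^ ζ / ζ) := by
      have := (subbotinConst_pos hζ).ne'
      rw [subbotinPDF, Real.exp_neg]
      field_simp
    refine (h1.trans_eq h2).trans (Real.exp_le_exp.2 ?_)
    have : |x| ^ ζ ≤ T ^ ζ := Real.rpow_le_rpow (abs_nonneg _) h hζ.le
    gcongr
  · exact (Real.exp_pos _).le

/-- The integral is the chance that v + ε lands in [-T, T]. By symmetry `tail ζ (v - T)` is the
chance of ε ≤ T - v, and as v ≥ 0 the part below -T - v costs at most `tail ζ T`. -/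
lemma integral_truncRatio_ge (hζ : 0 < ζ) {v T : ℝ} (hv : 0 ≤ v) :
    tail ζ (v - T) - tail ζ T ≤ ∫ x, truncRatio ζ v T x ∂(subbotin ζ) := by
  have := isProbabilityMeasure_subbotin hζ
  have := isProbabilityMeasure_shifted hζ v
  have h1 : ∫ x, truncRatio ζ v T x ∂(subbotin ζ) = (shifted ζ v).real (Set.Icc (-T) T) := by
    rw [measureReal_def, shifted_eq_withDensity hζ, withDensity_apply _ measurableSet_Icc,
      ← lintegral_indicator measurableSet_Icc, integral_eq_lintegral_of_nonneg_ae
        (ae_of_all _ (truncRatio_nonneg hζ v T)) (measurable_truncRatio v T).aestronglyMeasurable]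
    congr 2 with x
    by_cases hx : |x| ≤ T <;> simp [truncRatio, hx, Set.indicator, ← abs_le]
  have h2 : (shifted ζ v).real (Set.Icc (-T) T) = (subbotin ζ).real (Set.Icc (-T - v) (T - v)) := by
    rw [shifted, map_measureReal_apply (by fun_prop) measurableSet_Icc]
    simp
  have h3 : Set.Iic (T - v) ⊆ Set.Icc (-T - v) (T - v) ∪ Set.Iic (-T) := by
    intro x hx
    simp only [Set.mem_Iic, Set.mem_union, Set.mem_Icc] at *
    by_cases h : x ≤ -T
    · exact Or.inr h
    · exact Or.inl ⟨by linarith, hx⟩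
  have h4 := (measureReal_mono h3 (by simp)).trans
    (measureReal_union_le (μ := subbotin ζ) (Set.Icc (-T - v) (T - v)) (Set.Iic (-T)))
  rw [h1, h2, tail_eq_Iic hζ, tail_eq_Iic hζ, neg_sub]
  linarith

end Subbotin

/-! ### Product laws, change of measure, and the Bayes bound in one block. -/

section Product

variable {ζ : ℝ} {n : ℕ}

/-- It suffices to test boxes, where the integrand is a product of functions of independent
coordinates. -/
lemma pi_withDensity_eval {ι : Type*} [Fintype ι] [DecidableEq ι] {μ : ι → Measure ℝ}
    [∀ i, IsProbabilityMeasure (μ i)] (k : ι) {h : ℝ → ENNReal} (hh : Measurable h)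
    [IsProbabilityMeasure ((μ k).withDensity h)] :
    (Measure.pi μ).withDensity (fun x => h (x k))
      = Measure.pi (Function.update μ k ((μ k).withDensity h)) := by
  have (i : ι) : IsProbabilityMeasure (Function.update μ k ((μ k).withDensity h) i) := by
    rcases eq_or_ne i k with rfl | hi
    · simpa
    · simpa [hi] using inferInstanceAs (IsProbabilityMeasure (μ i))
  refine (Measure.pi_eq fun A hA => ?_).symm
  let X : ι → ℝ → ENNReal := fun i => (A i).indicator (if i = k then h else 1)
  have hX (i : ι) : Measurable (X i) := by
    refine Measurable.indicator ?_ (hA i)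
    split_ifs
    exacts [hh, measurable_one]
  rw [withDensity_apply _ (.univ_pi hA), ← lintegral_indicator (.univ_pi hA)]
  have h1 (x : ι → ℝ) : (Set.univ.pi A).indicator (fun x => h (x k)) x = ∏ i, X i (x i) := by
    by_cases hx : x ∈ Set.univ.pi A
    · rw [Set.indicator_of_mem hx]
      have (i : ι) : X i (x i) = if i = k then h (x k) else 1 := by
        rw [show X i (x i) = _ from Set.indicator_of_mem (hx i trivial) _]
        split_ifs with hi
        · rw [hi]
        · rfl
      simp [this]
    · rw [Set.indicator_of_notMem hx]
      simp only [Set.mem_pi, Set.mem_univ, true_imp_iff, not_forall] at hx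
      obtain ⟨i, hi⟩ := hx
      exact (Finset.prod_eq_zero (Finset.mem_univ i) (Set.indicator_of_notMem hi _)).symm
  simp_rw [h1]
  rw [lintegral_prod_eq_prod_lintegral_of_indepFun Finset.univ (fun i (x : ι → ℝ) => X i (x i))
    (iIndepFun_pi fun i => (hX i).aemeasurable) fun i => (hX i).comp (measurable_pi_apply i)]
  refine Finset.prod_congr rfl fun i _ => ?_
  rw [← lintegral_map (hX i) (measurable_pi_apply i), (measurePreserving_eval μ i).map_eq,
    lintegral_indicator (hA i)]
  rcases eq_or_ne i k with rfl | hi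
  · simp [withDensity_apply _ (hA i)]
  · simp [hi]

/-- Variances of independent terms add, and 0 ≤ X ≤ D gives Var X ≤ (D - EX)·EX ≤ D·EX. -/
lemma integral_sq_sum_sub_le {ι : Type*} [Fintype ι] {μ : ι → Measure ℝ}
    [∀ i, IsProbabilityMeasure (μ i)] {X : ι → ℝ → ℝ} (hX : ∀ i, Measurable (X i)) {D : ℝ}
    (h0 : ∀ i x, 0 ≤ X i x) (hD : ∀ i x, X i x ≤ D) (S : Finset ι) :
    ∫ x, (∑ i ∈ S, X i (x i) - ∑ i ∈ S, ∫ y, X i y ∂(μ i)) ^ 2 ∂(Measure.pi μ)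
      ≤ D * ∑ i ∈ S, ∫ y, X i y ∂(μ i) := by
  have hL (i : ι) : MemLp (fun x : ι → ℝ => X i (x i)) 2 (Measure.pi μ) :=
    MemLp.of_bound ((hX i).comp (measurable_pi_apply i)).aestronglyMeasurable D
      (ae_of_all _ fun x => by rw [Real.norm_of_nonneg (h0 _ _)]; exact hD _ _)
  have hm (i : ι) : ∫ x, X i (x i) ∂(Measure.pi μ) = ∫ y, X i y ∂(μ i) :=
    integral_comp_eval (hX i).aestronglyMeasurable
  have hv := IndepFun.variance_sum (s := S) (fun i _ => hL i) fun i _ j _ hij =>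
    (iIndepFun_pi fun i => (hX i).aemeasurable (μ := μ i)).indepFun hij
  rw [variance_eq_integral (Finset.aemeasurable_sum _ fun i _ => (hL i).aemeasurable)] at hv
  simp only [Finset.sum_apply] at hv
  rw [integral_finsetSum _ fun i _ => (hL i).integrable (by norm_num)] at hv
  simp_rw [hm] at hv
  rw [hv, Finset.mul_sum]
  refine Finset.sum_le_sum fun i _ => ?_
  have := variance_le_sub_mul_sub (ae_of_all _ fun x : ι → ℝ => ⟨h0 i (x i), hD i (x i)⟩)
    (hL i).aemeasurable
  rw [hm] at this
  nlinarith [integral_nonneg (μ := μ i) (f := X i) (h0 i)]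

lemma law_eq_pi (hζ : 0 < ζ) (θ : Fin n → ℝ) :
    law ζ θ = Measure.pi fun i => shifted ζ (θ i) := by
  have (i : Fin n) := isProbabilityMeasure_shifted hζ (θ i)
  unfold shifted at *
  exact Measure.pi_map_pi fun i => by fun_prop

lemma isProbabilityMeasure_law (hζ : 0 < ζ) (θ : Fin n → ℝ) : IsProbabilityMeasure (law ζ θ) := by
  have (i : Fin n) := isProbabilityMeasure_shifted hζ (θ i)
  rw [law_eq_pi hζ]
  infer_instance

lemma integrable_law_of_bound (hζ : 0 < ζ) (θ : Fin n → ℝ) {g : (Fin n → ℝ) → ℝ}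
    (hg : Measurable g) {C : ℝ} (hC : ∀ x, |g x| ≤ C) : Integrable g (law ζ θ) :=
  have := isProbabilityMeasure_law hζ θ
  .of_bound hg.aestronglyMeasurable C (ae_of_all _ hC)

lemma integral_law_comp_eval (hζ : 0 < ζ) (θ : Fin n → ℝ) (k : Fin n) {g : ℝ → ℝ}
    (hg : Measurable g) : ∫ x, g (x k) ∂(law ζ θ) = ∫ y, g y ∂(shifted ζ (θ k)) := by
  have (i : Fin n) := isProbabilityMeasure_shifted hζ (θ i)
  rw [law_eq_pi hζ]
  exact integral_comp_eval hg.aestronglyMeasurable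

lemma law_add_single (hζ : 0 < ζ) (θ : Fin n → ℝ) {k : Fin n} (hk : θ k = 0) (v : ℝ) :
    law ζ (θ + Pi.single k v) = (law ζ θ).withDensity
      fun x => ENNReal.ofReal (subbotinPDF ζ (x k - v) / subbotinPDF ζ (x k)) := by
  have (i : Fin n) := isProbabilityMeasure_shifted hζ (θ i)
  have hv := shifted_eq_withDensity hζ v
  have hP := isProbabilityMeasure_shifted hζ v
  have hm := measurable_subbotinPDF (ζ := ζ)
  rw [hv, ← shifted_zero, ← hk] at hP
  rw [law_eq_pi hζ, law_eq_pi hζ, pi_withDensity_eval (μ := fun i => shifted ζ (θ i)) k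
    (h := fun x => ENNReal.ofReal (subbotinPDF ζ (x - v) / subbotinPDF ζ x)) (by fun_prop)]
  congr 1 with i
  rcases eq_or_ne i k with rfl | hi
  · simp [hk, shifted_zero, hv]
  · simp [hi]

/-- Change of measure moves the shift into the law; truncation only discards nonnegative mass. -/
lemma integral_truncRatio_mul_le (hζ : 0 < ζ) (θ : Fin n → ℝ) {k : Fin n} (hk : θ k = 0)
    (v T : ℝ) {g : (Fin n → ℝ) → ℝ} (hg : Measurable g) (h0 : ∀ x, 0 ≤ g x) {C : ℝ}
    (hC : ∀ x, g x ≤ C) :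
    ∫ x, truncRatio ζ v T (x k) * g x ∂(law ζ θ) ≤ ∫ x, g x ∂(law ζ (θ + Pi.single k v)) := by
  have hm := measurable_subbotinPDF (ζ := ζ)
  have hT : MeasurableSet {x : Fin n → ℝ | |x k| ≤ T} :=
    measurableSet_le (by fun_prop) (by fun_prop)
  have h1 : ∫ x, truncRatio ζ v T (x k) * g x ∂(law ζ θ)
      = ∫ x, {x : Fin n → ℝ | |x k| ≤ T}.indicator g x ∂(law ζ (θ + Pi.single k v)) := by
    rw [law_add_single hζ θ hk, integral_withDensity_eq_integral_toReal_smul (by fun_prop)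
      (ae_of_all _ fun x => ENNReal.ofReal_lt_top)]
    congr 1 with x
    by_cases hx : |x k| ≤ T
    · simp [truncRatio, hx,
        ENNReal.toReal_ofReal (div_pos (subbotinPDF_pos hζ _) (subbotinPDF_pos hζ _)).le]
    · simp [truncRatio, hx]
  have hi : Integrable g (law ζ (θ + Pi.single k v)) :=
    integrable_law_of_bound hζ _ hg fun x => by rw [abs_of_nonneg (h0 x)]; exact hC x
  rw [h1]
  exact integral_mono (hi.indicator hT) hi fun x => Set.indicator_le_self' (fun _ _ => h0 _) _

/-- If S ≥ μ/2, then cS ≥ D ≥ y and every ψ in [0, 1] costs at least y. Otherwise (S - μ)² ≥ μ²/4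
and the left side is nonpositive. -/
lemma mul_one_sub_add_mul_ge {y ψ c S D μ : ℝ} (hy : 0 ≤ y) (hyD : y ≤ D) (hD : D ≤ c * μ / 2)
    (hc : 0 < c) (hμ : 0 < μ) (hS : 0 ≤ S) (h0 : 0 ≤ ψ) (h1 : ψ ≤ 1) :
    y - 4 / μ ^ 2 * (y * (S - μ) ^ 2) ≤ y * (1 - ψ) + c * (ψ * S) := by
  rcases le_or_gt (μ / 2) S with h | h
  · have : 0 ≤ 4 / μ ^ 2 * (y * (S - μ) ^ 2) := by positivity
    have : y ≤ c * S := by nlinarith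
    nlinarith
  · have h2 : 1 ≤ 4 / μ ^ 2 * (S - μ) ^ 2 := by
      rw [div_mul_eq_mul_div, one_le_div (by positivity)]
      nlinarith
    have : 0 ≤ y * (1 - ψ) := mul_nonneg hy (by linarith)
    have : 0 ≤ c * (ψ * S) := by positivity
    nlinarith

/-- Lower bound for the weighted misclassification risk of locating, within a block `B`, one
signal of size `v` placed uniformly at random. -/
lemma block_risk_ge (hζ : 0 < ζ) (θ : Fin n → ℝ) {B : Finset (Fin n)} (hB : ∀ i ∈ B, θ i = 0)
    (hcard : 2 ≤ B.card) (v T : ℝ) {c : ℝ} (hc : 0 < c) {ψ : (Fin n → ℝ) → Fin n → ℝ}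
    (hψ : ∀ i, Measurable fun x => ψ x i) (h0 : ∀ x i, 0 ≤ ψ x i) (h1 : ∀ x i, ψ x i ≤ 1) :
    (B.card : ℝ) * (∫ y, truncRatio ζ v T y ∂(subbotin ζ)
        - (4 + 2 / c) * (Real.exp (T ^ ζ / ζ) / (B.card - 1)))
      ≤ ∑ k ∈ B, ∫ x, (1 - ψ x k + c * ∑ i ∈ B.erase k, ψ x i)
          ∂(law ζ (θ + Pi.single k v)) := by
  have (i : Fin n) := isProbabilityMeasure_shifted hζ (θ i)
  have hY := measurable_truncRatio (ζ := ζ) v T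
  have hY0 := truncRatio_nonneg hζ v T
  have hYD := truncRatio_le hζ v T
  set Y := truncRatio ζ v T
  set D := Real.exp (T ^ ζ / ζ)
  set p := ∫ y, Y y ∂(subbotin ζ) with hp
  set m : ℝ := (B.card : ℝ) with hm
  have hm2 : 2 ≤ m := by rw [hm]; exact_mod_cast hcard
  have hm1 : 0 < m - 1 := by linarith
  have hDpos : 0 < D := Real.exp_pos _
  have hp0 : 0 ≤ p := integral_nonneg hY0
  have hg0 (k : Fin n) (x : Fin n → ℝ) : 0 ≤ 1 - ψ x k + c * ∑ i ∈ B.erase k, ψ x i :=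
    add_nonneg (sub_nonneg.2 (h1 x k)) (mul_nonneg hc.le (Finset.sum_nonneg fun i _ => h0 x i))
  -- For small p the claimed bound is nonpositive; for large p the inequality D ≤ cμ/2 holds.
  rcases lt_or_ge p (2 / c * (D / (m - 1))) with hsmall | hlarge
  · refine le_trans (mul_nonpos_of_nonneg_of_nonpos (by linarith) ?_)
      (Finset.sum_nonneg fun k _ => integral_nonneg (hg0 k))
    have : 0 < D / (m - 1) := by positivity
    linarith
  set μ := (m - 1) * p with hμ
  have hppos : 0 < p := lt_of_lt_of_le (by positivity) hlarge
  have hμpos : 0 < μ := mul_pos hm1 hppos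
  have hDμ : D ≤ c * μ / 2 := by
    have : 2 / c * (D / (m - 1)) * (c * (m - 1) / 2) ≤ p * (c * (m - 1) / 2) :=
      mul_le_mul_of_nonneg_right hlarge (by positivity)
    have h2 : 2 / c * (D / (m - 1)) * (c * (m - 1) / 2) = D := by field_simp
    rw [hμ]
    linarith
  have hS0 (k : Fin n) (x : Fin n → ℝ) : 0 ≤ ∑ i ∈ B.erase k, Y (x i) :=
    Finset.sum_nonneg fun i _ => hY0 _
  have hSD (k : Fin n) (x : Fin n → ℝ) : ∑ i ∈ B.erase k, Y (x i) ≤ n * D := by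
    refine (Finset.sum_le_card_nsmul _ _ D fun i _ => hYD _).trans ?_
    rw [nsmul_eq_mul]
    gcongr
    exact (Finset.card_le_univ _).trans_eq (Fintype.card_fin n)
  have hmean (k : Fin n) (hk : k ∈ B) : ∫ x, Y (x k) ∂(law ζ θ) = p := by
    rw [integral_law_comp_eval hζ θ k hY, hB k hk, shifted_zero]
  have hsq (k : Fin n) (hk : k ∈ B) :
      ∫ x, Y (x k) * (∑ i ∈ B.erase k, Y (x i) - μ) ^ 2 ∂(law ζ θ) ≤ p * (D * μ) := by
    have hsum : ∑ i ∈ B.erase k, ∫ y, Y y ∂(shifted ζ (θ i)) = μ := by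
      rw [Finset.sum_congr rfl fun i hi => by
        rw [hB i (Finset.mem_of_mem_erase hi), shifted_zero, ← hp], Finset.sum_const,
        Finset.card_erase_of_mem hk, nsmul_eq_mul, hμ, hm, Nat.cast_sub (by omega), Nat.cast_one]
    have hind : IndepFun (fun x : Fin n → ℝ => Y (x k))
        (fun x => (∑ i ∈ B.erase k, Y (x i) - μ) ^ 2) (law ζ θ) := by
      have hI : iIndepFun (fun i (x : Fin n → ℝ) => Y (x i)) (law ζ θ) := by
        rw [law_eq_pi hζ]
        exact iIndepFun_pi fun i => hY.aemeasurable
      have := hI.indepFun_finsetSum_of_notMem (fun i => hY.comp (measurable_pi_apply i))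
        (Finset.notMem_erase k B)
      have := this.symm.comp (φ := id) (ψ := fun z => (z - μ) ^ 2) measurable_id (by fun_prop)
      simpa [Function.comp_def, Finset.sum_apply] using this
    rw [hind.integral_fun_mul_eq_mul_integral (Measurable.aestronglyMeasurable (by fun_prop))
      (Measurable.aestronglyMeasurable (by fun_prop)), hmean k hk, ← hsum]
    refine mul_le_mul_of_nonneg_left ?_ hp0
    rw [law_eq_pi hζ]
    exact integral_sq_sum_sub_le (fun _ => hY) (fun _ => hY0) (fun _ => hYD) _
  have hgC (k : Fin n) (x : Fin n → ℝ) : 1 - ψ x k + c * ∑ i ∈ B.erase k, ψ x i ≤ 1 + c * n := by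
    have : ∑ i ∈ B.erase k, ψ x i ≤ n := by
      refine (Finset.sum_le_card_nsmul _ _ 1 fun i _ => h1 x i).trans ?_
      rw [nsmul_eq_mul, mul_one]
      exact_mod_cast (Finset.card_le_univ _).trans_eq (Fintype.card_fin n)
    have := mul_le_mul_of_nonneg_left this hc.le
    linarith [h0 x k]
  have hgm (k : Fin n) : Measurable fun x => 1 - ψ x k + c * ∑ i ∈ B.erase k, ψ x i := by
    fun_prop
  have hY1 (k : Fin n) : Integrable (fun x : Fin n → ℝ => Y (x k)) (law ζ θ) :=
    integrable_law_of_bound hζ θ (by fun_prop) (C := D) fun x => by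
      rw [abs_of_nonneg (hY0 _)]; exact hYD _
  have hY2 (k : Fin n) :
      Integrable (fun x : Fin n → ℝ => Y (x k) * (∑ i ∈ B.erase k, Y (x i) - μ) ^ 2)
        (law ζ θ) := by
    refine integrable_law_of_bound hζ θ (by fun_prop) (C := D * (n * D + μ) ^ 2) fun x => ?_
    rw [abs_of_nonneg (mul_nonneg (hY0 _) (sq_nonneg _))]
    refine mul_le_mul (hYD _) (sq_le_sq' ?_ ?_) (sq_nonneg _) hDpos.le <;>
      nlinarith [hS0 k x, hSD k x, (Nat.cast_nonneg n : (0 : ℝ) ≤ n)]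
  have hY3 (k : Fin n) : Integrable (fun x : Fin n → ℝ =>
      Y (x k) * (1 - ψ x k + c * ∑ i ∈ B.erase k, ψ x i)) (law ζ θ) := by
    refine integrable_law_of_bound hζ θ (by fun_prop) (C := D * (1 + c * n)) fun x => ?_
    rw [abs_of_nonneg (mul_nonneg (hY0 _) (hg0 k x))]
    exact mul_le_mul (hYD _) (hgC k x) (hg0 k x) hDpos.le
  calc m * (p - (4 + 2 / c) * (D / (m - 1)))
      ≤ ∑ k ∈ B, (p - 4 / μ ^ 2 * (p * (D * μ))) := by
        rw [Finset.sum_const, nsmul_eq_mul]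
        refine mul_le_mul_of_nonneg_left ?_ (by linarith)
        have h4 : 4 / μ ^ 2 * (p * (D * μ)) = 4 * (D / (m - 1)) := by
          rw [hμ]
          field_simp
        have : 0 ≤ 2 / c * (D / (m - 1)) := by positivity
        rw [h4]
        linarith
    _ ≤ ∑ k ∈ B, ∫ x, (Y (x k) - 4 / μ ^ 2 * (Y (x k) * (∑ i ∈ B.erase k, Y (x i) - μ) ^ 2))
          ∂(law ζ θ) := by
        refine Finset.sum_le_sum fun k hk => ?_
        rw [integral_sub (hY1 k) ((hY2 k).const_mul _), integral_const_mul, hmean k hk]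
        have := mul_le_mul_of_nonneg_left (hsq k hk) (show 0 ≤ 4 / μ ^ 2 by positivity)
        linarith
    _ = ∫ x, ∑ k ∈ B, (Y (x k) - 4 / μ ^ 2 * (Y (x k) * (∑ i ∈ B.erase k, Y (x i) - μ) ^ 2))
          ∂(law ζ θ) :=
        (integral_finsetSum _ fun k _ => (hY1 k).sub ((hY2 k).const_mul _)).symm
    _ ≤ ∫ x, ∑ k ∈ B, Y (x k) * (1 - ψ x k + c * ∑ i ∈ B.erase k, ψ x i) ∂(law ζ θ) := by
        refine integral_mono (integrable_finsetSum _ fun k _ => (hY1 k).sub ((hY2 k).const_mul _))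
          (integrable_finsetSum _ fun k _ => hY3 k) fun x => ?_
        -- Exchanging the roles of k and i charges each rejection with the likelihood ratios of the
        -- other positions.
        have hswap : ∑ k ∈ B, Y (x k) * ∑ i ∈ B.erase k, ψ x i
            = ∑ k ∈ B, ψ x k * ∑ i ∈ B.erase k, Y (x i) := by
          simp_rw [Finset.mul_sum]
          rw [Finset.sum_comm' (t' := B) (s' := fun i => B.erase i)]
          · exact Finset.sum_congr rfl fun i _ => Finset.sum_congr rfl fun k _ => mul_comm _ _
          · intro k i
            simp only [Finset.mem_erase]
            tauto
        have hrw : ∑ k ∈ B, Y (x k) * (1 - ψ x k + c * ∑ i ∈ B.erase k, ψ x i)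
            = ∑ k ∈ B, (Y (x k) * (1 - ψ x k) + c * (ψ x k * ∑ i ∈ B.erase k, Y (x i))) := by
          rw [Finset.sum_add_distrib, ← Finset.mul_sum, ← hswap, Finset.mul_sum,
            ← Finset.sum_add_distrib]
          exact Finset.sum_congr rfl fun k _ => by ring
        simp only [hrw]
        exact Finset.sum_le_sum fun k _ => mul_one_sub_add_mul_ge (hY0 _) (hYD _) hDμ hc hμpos
          (hS0 k x) (h0 x k) (h1 x k)
    _ = ∑ k ∈ B, ∫ x, Y (x k) * (1 - ψ x k + c * ∑ i ∈ B.erase k, ψ x i) ∂(law ζ θ) :=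
        integral_finsetSum _ fun k _ => hY3 k
    _ ≤ _ := Finset.sum_le_sum fun k hk =>
        integral_truncRatio_mul_le hζ θ (hB k hk) v T (hgm k) (hg0 k) (hgC k)

end Product

/-! ### The risk and its comparison with a Hamming loss. -/

section Risk

variable {ζ : ℝ} {n s : ℕ}

lemma Procedure.rej_nonneg (φ : Procedure n) (x : Fin n → ℝ) (i : Fin n) : 0 ≤ φ.rej x i := by
  unfold rej; split_ifs <;> norm_num

lemma Procedure.rej_le_one (φ : Procedure n) (x : Fin n → ℝ) (i : Fin n) : φ.rej x i ≤ 1 := by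
  unfold rej; split_ifs <;> norm_num

lemma Procedure.measurable_rej (φ : Procedure n) (i : Fin n) : Measurable fun x => φ.rej x i :=
  Measurable.ite (((measurable_pi_apply i).comp φ.2) (measurableSet_singleton true))
    measurable_const measurable_const

/-- The procedure that never rejects. -/
def neverReject (n : ℕ) : Procedure n := ⟨fun _ _ => false, measurable_const⟩

instance : Nonempty (Procedure n) := ⟨neverReject n⟩

lemma measurable_FDP (θ : Fin n → ℝ) (φ : Procedure n) : Measurable (FDP θ φ) := by
  have := φ.measurable_rej
  refine Measurable.div (Finset.measurable_fun_sum _ fun i _ => ?_) (by fun_prop)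
  split_ifs <;> fun_prop

lemma measurable_FNP (θ : Fin n → ℝ) (φ : Procedure n) : Measurable (FNP θ φ) := by
  have := φ.measurable_rej
  refine Measurable.div (Finset.measurable_fun_sum _ fun i _ => ?_) (by fun_prop)
  split_ifs <;> fun_prop

lemma FDP_nonneg (θ : Fin n → ℝ) (φ : Procedure n) (x : Fin n → ℝ) : 0 ≤ FDP θ φ x := by
  refine div_nonneg (Finset.sum_nonneg fun i _ => ?_) (by positivity)
  split_ifs
  exacts [φ.rej_nonneg x i, le_rfl]

lemma FDP_le_one (θ : Fin n → ℝ) (φ : Procedure n) (x : Fin n → ℝ) : FDP θ φ x ≤ 1 := by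
  refine div_le_one_of_le₀ (le_max_of_le_right (Finset.sum_le_sum fun i _ => ?_)) (by positivity)
  split_ifs
  exacts [le_rfl, φ.rej_nonneg x i]

lemma FNP_nonneg (θ : Fin n → ℝ) (φ : Procedure n) (x : Fin n → ℝ) : 0 ≤ FNP θ φ x := by
  refine div_nonneg (Finset.sum_nonneg fun i _ => ?_) (by positivity)
  split_ifs
  exacts [sub_nonneg.2 (φ.rej_le_one x i), le_rfl]

lemma FNP_le_one (θ : Fin n → ℝ) (φ : Procedure n) (x : Fin n → ℝ) : FNP θ φ x ≤ 1 := by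
  refine div_le_one_of_le₀ (le_max_of_le_right (Finset.sum_le_sum fun i _ => ?_)) (by positivity)
  split_ifs
  exacts [sub_le_self _ (φ.rej_nonneg x i), le_rfl]

lemma integrable_FDP (hζ : 0 < ζ) (θ : Fin n → ℝ) (φ : Procedure n) :
    Integrable (FDP θ φ) (law ζ θ) :=
  integrable_law_of_bound hζ θ (measurable_FDP θ φ) (C := 1) fun x => by
    rw [abs_of_nonneg (FDP_nonneg θ φ x)]; exact FDP_le_one θ φ x

lemma integrable_FNP (hζ : 0 < ζ) (θ : Fin n → ℝ) (φ : Procedure n) :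
    Integrable (FNP θ φ) (law ζ θ) :=
  integrable_law_of_bound hζ θ (measurable_FNP θ φ) (C := 1) fun x => by
    rw [abs_of_nonneg (FNP_nonneg θ φ x)]; exact FNP_le_one θ φ x

lemma risk_eq_integral (hζ : 0 < ζ) (θ : Fin n → ℝ) (φ : Procedure n) :
    risk ζ θ φ = ∫ x, (FDP θ φ x + FNP θ φ x) ∂(law ζ θ) :=
  (integral_add (integrable_FDP hζ θ φ) (integrable_FNP hζ θ φ)).symm

lemma risk_nonneg (θ : Fin n → ℝ) (φ : Procedure n) : 0 ≤ risk ζ θ φ :=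
  add_nonneg (integral_nonneg (FDP_nonneg θ φ)) (integral_nonneg (FNP_nonneg θ φ))

lemma risk_le_two (hζ : 0 < ζ) (θ : Fin n → ℝ) (φ : Procedure n) : risk ζ θ φ ≤ 2 := by
  have := isProbabilityMeasure_law hζ θ
  rw [risk_eq_integral hζ]
  refine (integral_mono ((integrable_FDP hζ θ φ).add (integrable_FNP hζ θ φ))
    (integrable_const 2) fun x => ?_).trans_eq (by simp)
  have := FDP_le_one θ φ x
  have := FNP_le_one θ φ x
  simp only [Pi.add_apply]
  linarith

lemma risk_le_iSup (hζ : 0 < ζ) {Θ : Set (Fin n → ℝ)} {θ : Fin n → ℝ} (hθ : θ ∈ Θ)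
    (φ : Procedure n) : risk ζ θ φ ≤ ⨆ θ : Θ, risk ζ θ.1 φ :=
  le_ciSup (f := fun θ : Θ => risk ζ θ.1 φ)
    ⟨2, Set.forall_mem_range.2 fun θ => risk_le_two hζ θ.1 φ⟩ ⟨θ, hθ⟩

lemma le_minimaxRisk (hζ : 0 < ζ) {Θ : Set (Fin n → ℝ)} {r : ℝ}
    (h : ∀ φ : Procedure n, ∃ θ ∈ Θ, r ≤ risk ζ θ φ) : r ≤ minimaxRisk ζ Θ :=
  le_ciInf fun φ => by
    obtain ⟨θ, hθ, hr⟩ := h φ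
    exact hr.trans (risk_le_iSup hζ hθ φ)

lemma minimaxRisk_le {Θ : Set (Fin n → ℝ)} (hΘ : Θ.Nonempty) {r : ℝ} (φ : Procedure n)
    (h : ∀ θ ∈ Θ, risk ζ θ φ ≤ r) : minimaxRisk ζ Θ ≤ r := by
  have := hΘ.to_subtype
  refine (ciInf_le ⟨0, Set.forall_mem_range.2 fun φ => ?_⟩ φ).trans (ciSup_le fun θ => h θ.1 θ.2)
  exact Real.iSup_nonneg fun θ => risk_nonneg θ.1 φ

/-- `w` enumerates the nonzero coordinates of `θ`. -/
structure EnumeratesSupport (θ : Fin n → ℝ) (w : Fin s → Fin n) : Prop where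
  injective : Function.Injective w
  ne_zero_iff : ∀ i, θ i ≠ 0 ↔ ∃ j, w j = i

namespace EnumeratesSupport

variable {θ : Fin n → ℝ} {w : Fin s → Fin n}

lemma sum_eq (h : EnumeratesSupport θ w) (g : Fin n → ℝ) :
    (∑ i, if θ i ≠ 0 then g i else 0) = ∑ j, g (w j) := by
  classical
  rw [← Finset.sum_filter, ← Finset.sum_image (f := g) (s := Finset.univ) h.injective.injOn]
  congr 1
  ext i
  simp [h.ne_zero_iff]

lemma FNP_eq (h : EnumeratesSupport θ w) (hs : 1 ≤ s) (φ : Procedure n) (x : Fin n → ℝ) :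
    FNP θ φ x = (∑ j, (1 - φ.rej x (w j))) / s := by
  have : (1 : ℝ) ≤ s := by exact_mod_cast hs
  rw [FNP, h.sum_eq fun i => 1 - φ.rej x i, h.sum_eq fun _ => 1]
  simp [this]

lemma sum_rej_eq (h : EnumeratesSupport θ w) (φ : Procedure n) (x : Fin n → ℝ) :
    ∑ i, φ.rej x i = (∑ i, if θ i = 0 then φ.rej x i else 0) + ∑ j, φ.rej x (w j) := by
  rw [← h.sum_eq, ← Finset.sum_add_distrib]
  refine Finset.sum_congr rfl fun i _ => ?_
  by_cases hi : θ i = 0 <;> simp [hi]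

end EnumeratesSupport

/-- The rejections of `φ`, discarded altogether when there are more than `K` of them. -/
def Procedure.capped (φ : Procedure n) (K : ℝ) (x : Fin n → ℝ) (i : Fin n) : ℝ :=
  if ∑ i, φ.rej x i ≤ K then φ.rej x i else 0

lemma Procedure.capped_nonneg (φ : Procedure n) (K : ℝ) (x : Fin n → ℝ) (i : Fin n) :
    0 ≤ φ.capped K x i := by
  unfold capped
  split_ifs
  exacts [φ.rej_nonneg x i, le_rfl]

lemma Procedure.capped_le_one (φ : Procedure n) (K : ℝ) (x : Fin n → ℝ) (i : Fin n) :
    φ.capped K x i ≤ 1 := by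
  unfold capped
  split_ifs
  exacts [φ.rej_le_one x i, zero_le_one]

lemma Procedure.measurable_capped (φ : Procedure n) (K : ℝ) (i : Fin n) :
    Measurable fun x => φ.capped K x i := by
  have := φ.measurable_rej
  exact Measurable.ite (measurableSet_le (by fun_prop) (by fun_prop)) (by fun_prop) (by fun_prop)

/-- With at most s/c rejections, the FDP denominator is at most s/c. With more, the at most s true
ones are a fraction below c, so FDP ≥ 1 - c, which covers the capped loss of missing everything. -/
lemma FDP_add_FNP_ge {θ : Fin n → ℝ} {w : Fin s → Fin n} (h : EnumeratesSupport θ w)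
    (hs : 1 ≤ s) {c : ℝ} (hc : 0 < c) (hc1 : c ≤ 1) (φ : Procedure n) (x : Fin n → ℝ) :
    (∑ j, (1 - φ.capped (s / c) x (w j))
        + c * ∑ i, if θ i = 0 then φ.capped (s / c) x i else 0) / s - c
      ≤ FDP θ φ x + FNP θ φ x := by
  have hs' : (1 : ℝ) ≤ s := by exact_mod_cast hs
  have hs0 : (0 : ℝ) < s := by linarith
  have hV0 : 0 ≤ ∑ i, if θ i = 0 then φ.rej x i else 0 := Finset.sum_nonneg fun i _ => by
    split_ifs
    exacts [φ.rej_nonneg x i, le_rfl]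
  have hR := h.sum_rej_eq φ x
  by_cases hcap : ∑ i, φ.rej x i ≤ s / c
  · have hψ (i : Fin n) : φ.capped (s / c) x i = φ.rej x i := if_pos hcap
    simp only [hψ]
    rw [h.FNP_eq hs, FDP]
    have hmax : max 1 (∑ i, φ.rej x i) ≤ s / c := by
      refine max_le ?_ hcap
      rw [one_le_div hc]
      linarith
    have : c * (∑ i, if θ i = 0 then φ.rej x i else 0) / s
        ≤ (∑ i, if θ i = 0 then φ.rej x i else 0) / max 1 (∑ i, φ.rej x i) := by
      calc _ = (∑ i, if θ i = 0 then φ.rej x i else 0) / (s / c) := by field_simp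
        _ ≤ _ := div_le_div_of_nonneg_left hV0 (by positivity) hmax
    rw [add_div]
    linarith
  · have hψ (i : Fin n) : φ.capped (s / c) x i = 0 := if_neg hcap
    simp only [hψ]
    have h1 : s / c < ∑ i, φ.rej x i := not_le.1 hcap
    have h2 : 1 < ∑ i, φ.rej x i := lt_of_le_of_lt ((one_le_div hc).2 (by linarith)) h1
    have hT : ∑ j, φ.rej x (w j) ≤ s := by
      refine (Finset.sum_le_card_nsmul _ _ 1 fun j _ => φ.rej_le_one x (w j)).trans ?_
      simp
    have : 1 - c ≤ FDP θ φ x := by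
      rw [FDP, max_eq_right h2.le, le_div_iff₀ (by linarith)]
      have : s < c * ∑ i, φ.rej x i := by rwa [div_lt_iff₀' hc] at h1
      nlinarith
    have h3 := FNP_nonneg θ φ x
    simp only [sub_zero, Finset.sum_const, Finset.card_univ, Fintype.card_fin, nsmul_eq_mul,
      mul_one, ite_self, mul_zero, add_zero]
    rw [div_self hs0.ne']
    linarith

end Risk

/-- Resampling one coordinate of a uniform κ leaves it uniform: exchanging κ j with k is an
involution on pairs (κ, k). -/
lemma sum_sum_update {ι β M : Type*} [Fintype ι] [DecidableEq ι] [Fintype β] [AddCommMonoid M]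
    (j : ι) (g : (ι → β) → M) :
    ∑ κ : ι → β, ∑ k, g (Function.update κ j k) = Fintype.card β • ∑ κ, g κ := by
  let e : (ι → β) × β ≃ (ι → β) × β :=
    { toFun := fun z => (Function.update z.1 j z.2, z.1 j)
      invFun := fun z => (Function.update z.1 j z.2, z.1 j)
      left_inv := fun z => by simp
      right_inv := fun z => by simp }
  have h := e.sum_comp fun z => g z.1
  rw [Fintype.sum_prod_type, Fintype.sum_prod_type] at h
  refine h.trans ?_
  simp [Finset.smul_sum]

/-! ### Lower bound: one random signal per block. -/

section LowerBound

variable {ζ : ℝ} {n s m : ℕ}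

/-- The configuration with one signal in each block: signal `j` has size `v j` and sits at the
`κ j`-th position of block `j`. -/
def blockSignal (e : Fin s × Fin m ↪ Fin n) (v : Fin s → ℝ) (κ : Fin s → Fin m) : Fin n → ℝ :=
  ∑ j, Pi.single (e (j, κ j)) (v j)

variable (e : Fin s × Fin m ↪ Fin n) {v : Fin s → ℝ} (κ : Fin s → Fin m)

lemma blockSignal_apply (j : Fin s) : blockSignal e v κ (e (j, κ j)) = v j := by
  rw [blockSignal, Finset.sum_apply, Finset.sum_eq_single j]
  · simp
  · intro j' _ hj'
    exact Pi.single_eq_of_ne (fun h => hj' (Prod.ext_iff.1 (e.injective h)).1.symm) _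
  · simp

lemma blockSignal_enumeratesSupport (hv : ∀ j, 0 < v j) :
    EnumeratesSupport (blockSignal e v κ) fun j => e (j, κ j) where
  injective j j' h := (Prod.ext_iff.1 (e.injective h)).1
  ne_zero_iff i := by
    refine ⟨fun hi => ?_, ?_⟩
    · by_contra! h
      refine hi ?_
      rw [blockSignal, Finset.sum_apply]
      exact Finset.sum_eq_zero fun j _ => Pi.single_eq_of_ne (h j).symm _
    · rintro ⟨j, rfl⟩
      rw [blockSignal_apply]
      exact (hv j).ne'

/-- The coordinates of block `j`. -/
def block (j : Fin s) : Finset (Fin n) := Finset.univ.image fun k => e (j, k)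

lemma card_block (j : Fin s) : (block e j).card = m := by
  rw [block, Finset.card_image_of_injective _ fun k k' h => (Prod.ext_iff.1 (e.injective h)).2]
  simp

lemma sum_block (j : Fin s) (g : Fin n → ℝ) : ∑ i ∈ block e j, g i = ∑ k, g (e (j, k)) := by
  rw [block, Finset.sum_image fun k _ k' _ h => (Prod.ext_iff.1 (e.injective h)).2]

/-- The blocks are disjoint and all their other positions are null; nulls outside every block are
dropped, hence an inequality. -/
lemma sum_block_erase_le {g : Fin n → ℝ} (hg : ∀ i, 0 ≤ g i) (hv : ∀ j, 0 < v j) :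
    ∑ j, ∑ i ∈ (block e j).erase (e (j, κ j)), g i
      ≤ ∑ i, if blockSignal e v κ i = 0 then g i else 0 := by
  rw [← Finset.sum_biUnion, ← Finset.sum_filter]
  · refine Finset.sum_le_sum_of_subset_of_nonneg (fun i hi => ?_) fun i _ _ => hg i
    simp only [Finset.mem_biUnion, Finset.mem_univ, true_and, Finset.mem_erase, block,
      Finset.mem_image] at hi
    obtain ⟨j, hj, k, rfl⟩ := hi
    simp only [Finset.mem_filter, Finset.mem_univ, true_and]
    by_contra h
    obtain ⟨j', hj'⟩ := ((blockSignal_enumeratesSupport e κ hv).ne_zero_iff _).1 h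
    obtain rfl : j' = j := (Prod.ext_iff.1 (e.injective hj')).1
    exact hj hj'.symm
  · intro j _ j' _ hjj'
    refine Finset.disjoint_left.2 fun i hi hi' => hjj' ?_
    have h1 := Finset.mem_of_mem_erase hi
    have h2 := Finset.mem_of_mem_erase hi'
    simp only [block, Finset.mem_image, Finset.mem_univ, true_and] at h1 h2
    obtain ⟨k, rfl⟩ := h1
    obtain ⟨k', h⟩ := h2
    exact (Prod.ext_iff.1 (e.injective h)).1.symm

lemma blockSignal_update (j : Fin s) (k : Fin m) :
    blockSignal e v (Function.update κ j k)
      = ∑ j' ∈ Finset.univ.erase j, Pi.single (e (j', κ j')) (v j')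
        + Pi.single (e (j, k)) (v j) := by
  rw [blockSignal, ← Finset.sum_erase_add _ _ (Finset.mem_univ j), Function.update_self]
  congr 1
  refine Finset.sum_congr rfl fun j' hj' => ?_
  rw [Function.update_of_ne (Finset.ne_of_mem_erase hj')]

/-- Some κ does at least as badly as the average. In the average, the loss of block j is bounded by
resampling κ j with the other signals fixed. -/
lemma exists_blockSignal_risk_ge (hζ : 0 < ζ) (hs : 1 ≤ s) (hm : 2 ≤ m) (hv : ∀ j, 0 < v j)
    (T : ℝ) {c : ℝ} (hc : 0 < c) (hc1 : c ≤ 1) (φ : Procedure n) :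
    ∃ κ, (∑ j, (∫ y, truncRatio ζ (v j) T y ∂(subbotin ζ))) / s
        - (4 + 2 / c) * (Real.exp (T ^ ζ / ζ) / (m - 1)) - c
      ≤ risk ζ (blockSignal e v κ) φ := by
  have hs' : (0 : ℝ) < s := by exact_mod_cast hs
  have hm' : (0 : ℝ) < m := by exact_mod_cast (by omega : 0 < m)
  set E := (4 + 2 / c) * (Real.exp (T ^ ζ / ζ) / (m - 1)) with hE
  set ψ := φ.capped (s / c) with hψ
  have hψm : ∀ i, Measurable fun x => ψ x i := φ.measurable_capped _
  have hψ0 : ∀ x i, 0 ≤ ψ x i := φ.capped_nonneg _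
  have hψ1 : ∀ x i, ψ x i ≤ 1 := φ.capped_le_one _
  let L (κ : Fin s → Fin m) (j : Fin s) (x : Fin n → ℝ) : ℝ :=
    1 - ψ x (e (j, κ j)) + c * ∑ i ∈ (block e j).erase (e (j, κ j)), ψ x i
  have hLi (κ : Fin s → Fin m) (j : Fin s) : Integrable (L κ j) (law ζ (blockSignal e v κ)) := by
    refine integrable_law_of_bound hζ _ (by fun_prop) (C := 1 + c * m) fun x => ?_
    have h1 : 0 ≤ ∑ i ∈ (block e j).erase (e (j, κ j)), ψ x i :=
      Finset.sum_nonneg fun i _ => hψ0 x i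
    have h2 : ∑ i ∈ (block e j).erase (e (j, κ j)), ψ x i ≤ m := by
      refine (Finset.sum_le_card_nsmul _ _ 1 fun i _ => hψ1 x i).trans ?_
      rw [nsmul_eq_mul, mul_one]
      exact_mod_cast Finset.card_erase_le.trans_eq (card_block e j)
    have := hψ0 x (e (j, κ j))
    have := hψ1 x (e (j, κ j))
    rw [abs_le]
    constructor <;> nlinarith
  have hrisk (κ : Fin s → Fin m) :
      (∑ j, ∫ x, L κ j x ∂(law ζ (blockSignal e v κ))) / s - c
        ≤ risk ζ (blockSignal e v κ) φ := by
    have := isProbabilityMeasure_law hζ (blockSignal e v κ)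
    have hi := (integrable_finsetSum Finset.univ fun j _ => hLi κ j).div_const (s : ℝ)
    rw [risk_eq_integral hζ]
    calc _ = ∫ x, ((∑ j, L κ j x) / s - c) ∂(law ζ (blockSignal e v κ)) := by
          rw [integral_sub hi (integrable_const c), integral_div,
            integral_finsetSum _ fun j _ => hLi κ j]
          simp
      _ ≤ _ := by
          refine integral_mono (hi.sub (integrable_const c))
            ((integrable_FDP hζ _ φ).add (integrable_FNP hζ _ φ)) fun x => ?_
          refine le_trans ?_
            (FDP_add_FNP_ge (blockSignal_enumeratesSupport e κ hv) hs hc hc1 φ x)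
          have := mul_le_mul_of_nonneg_left (sum_block_erase_le e κ (hψ0 x) hv) hc.le
          simp only [L, Finset.sum_add_distrib, ← Finset.mul_sum]
          gcongr
  have hblock (κ : Fin s → Fin m) (j : Fin s) :
      m * ((∫ y, truncRatio ζ (v j) T y ∂(subbotin ζ)) - E)
        ≤ ∑ k, ∫ x, L (Function.update κ j k) j x
            ∂(law ζ (blockSignal e v (Function.update κ j k))) := by
    have h0 : ∀ i ∈ block e j,
        (∑ j' ∈ Finset.univ.erase j, Pi.single (e (j', κ j')) (v j') : Fin n → ℝ) i = 0 := by
      intro i hi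
      simp only [block, Finset.mem_image, Finset.mem_univ, true_and] at hi
      obtain ⟨k, rfl⟩ := hi
      rw [Finset.sum_apply]
      refine Finset.sum_eq_zero fun j' hj' => Pi.single_eq_of_ne (fun h => ?_) _
      exact Finset.ne_of_mem_erase hj' (Prod.ext_iff.1 (e.injective h)).1.symm
    have := block_risk_ge hζ _ h0 (by rwa [card_block]) (v j) T hc hψm hψ0 hψ1
    rw [card_block, sum_block] at this
    simpa only [L, Function.update_self, blockSignal_update] using this
  have hsum : ∑ _κ : Fin s → Fin m,
      ((∑ j, (∫ y, truncRatio ζ (v j) T y ∂(subbotin ζ))) / s - E - c)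
        ≤ ∑ κ : Fin s → Fin m, risk ζ (blockSignal e v κ) φ := by
    refine le_trans ?_ (Finset.sum_le_sum fun κ _ => hrisk κ)
    rw [Finset.sum_sub_distrib, Finset.sum_sub_distrib (f := fun κ : Fin s → Fin m =>
      (∑ j, ∫ x, L κ j x ∂(law ζ (blockSignal e v κ))) / s), ← Finset.sum_div,
      Finset.sum_comm]
    refine sub_le_sub_right ?_ _
    have hj (j : Fin s) :
        ∑ _κ : Fin s → Fin m, ((∫ y, truncRatio ζ (v j) T y ∂(subbotin ζ)) - E)
          ≤ ∑ κ, ∫ x, L κ j x ∂(law ζ (blockSignal e v κ)) := by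
      have := sum_sum_update j fun κ => ∫ x, L κ j x ∂(law ζ (blockSignal e v κ))
      rw [Fintype.card_fin, nsmul_eq_mul] at this
      refine le_of_mul_le_mul_left ?_ hm'
      rw [← this, Finset.mul_sum]
      exact Finset.sum_le_sum fun κ _ => hblock κ j
    refine le_trans (le_of_eq ?_) (div_le_div_of_nonneg_right
      (Finset.sum_le_sum fun j (_ : j ∈ Finset.univ) => hj j) hs'.le)
    simp only [Finset.sum_const, nsmul_eq_mul, ← Finset.mul_sum, Finset.sum_sub_distrib,
      Finset.card_univ, Fintype.card_fin]
    field_simp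
  have : Nonempty (Fin s → Fin m) := ⟨fun _ => ⟨0, by omega⟩⟩
  obtain ⟨κ, -, hκ⟩ := Finset.exists_le_of_sum_le Finset.univ_nonempty hsum
  exact ⟨κ, hκ⟩

lemma blockSignal_mem_signalClass (hv : ∀ j, 0 < v j) {b : Fin s → ℝ}
    (hb : ∀ j, oracleThreshold ζ n s + b j ≤ v j) :
    blockSignal e v κ ∈ signalClass ζ n b := by
  have hsupp := blockSignal_enumeratesSupport e κ hv
  refine ⟨?_, _, hsupp.injective, fun j => ?_⟩
  · have : {i | blockSignal e v κ i ≠ 0} = Set.range fun j => e (j, κ j) := by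
      ext i
      exact hsupp.ne_zero_iff i
    rw [ellZero, Set.mem_ofPred_eq, this, ← Set.image_univ]
    refine (Set.ncard_image_le Set.finite_univ).trans ?_
    simp
  · rw [blockSignal_apply]
    exact (hb j).trans (le_abs_self _)

lemma signalClass_nonempty (hn : s ≤ n) {b : Fin s → ℝ}
    (hb : ∀ j, -oracleThreshold ζ n s < b j) : (signalClass ζ n b).Nonempty :=
  ⟨_, blockSignal_mem_signalClass
    -- Blocks of length one suffice here.
    (finProdFinEquiv.toEmbedding.trans (Fin.castLEEmb ((mul_one s).trans_le hn)))
    (v := fun j => oracleThreshold ζ n s + b j) (fun _ => 0)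
    (fun j => by linarith [hb j]) fun _ => le_rfl⟩

/-- Truncation at T = a - δ rather than a shrinks the likelihood bound, and costs only a shift of
each b_j by δ. -/
lemma minimaxRisk_ge (hζ : 0 < ζ) (hs : 1 ≤ s) (hm : 2 ≤ m) (hn : s * m ≤ n) {b : Fin s → ℝ}
    (hb : ∀ j, -oracleThreshold ζ n s < b j) {δ : ℝ} (hδ : 0 ≤ δ) {c : ℝ} (hc : 0 < c)
    (hc1 : c ≤ 1) :
    avgTail ζ b - δ * (subbotinConst ζ)⁻¹ - tail ζ (oracleThreshold ζ n s - δ)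
        - (4 + 2 / c) * (Real.exp ((oracleThreshold ζ n s - δ) ^ ζ / ζ) / (m - 1)) - c
      ≤ minimaxRisk ζ (signalClass ζ n b) := by
  let e : Fin s × Fin m ↪ Fin n := finProdFinEquiv.toEmbedding.trans (Fin.castLEEmb hn)
  set a := oracleThreshold ζ n s with ha
  have hv (j : Fin s) : 0 < a + b j := by linarith [hb j]
  have hs' : (0 : ℝ) < s := by exact_mod_cast hs
  refine le_minimaxRisk hζ fun φ => ?_
  obtain ⟨κ, hκ⟩ := exists_blockSignal_risk_ge e hζ hs hm hv (a - δ) hc hc1 φ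
  refine ⟨_, blockSignal_mem_signalClass e κ hv fun _ => le_rfl, le_trans ?_ hκ⟩
  refine sub_le_sub_right (sub_le_sub_right ?_ _) _
  rw [le_div_iff₀ hs']
  have h1 (j : Fin s) : tail ζ (b j) - (δ * (subbotinConst ζ)⁻¹ + tail ζ (a - δ))
      ≤ ∫ y, truncRatio ζ (a + b j) (a - δ) y ∂(subbotin ζ) := by
    refine le_trans ?_ (integral_truncRatio_ge hζ (hv j).le)
    have := tail_sub_le_tail_add hζ (b j) hδ
    rw [show a + b j - (a - δ) = b j + δ by ring]
    linarith
  refine le_trans (le_of_eq ?_) (Finset.sum_le_sum fun j _ => h1 j)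
  rw [Finset.sum_sub_distrib, avgTail]
  simp only [Finset.sum_const, Finset.card_univ, Fintype.card_fin, nsmul_eq_mul]
  field_simp
  ring

end LowerBound

/-! ### Upper bound: thresholding at the oracle level, or never rejecting. -/

section UpperBound

variable {ζ : ℝ} {n s : ℕ}

lemma minimaxRisk_le_one (hζ : 0 < ζ) {Θ : Set (Fin n → ℝ)} (hΘ : Θ.Nonempty) :
    minimaxRisk ζ Θ ≤ 1 := by
  refine minimaxRisk_le hΘ (neverReject n) fun θ _ => ?_
  have := isProbabilityMeasure_law hζ θ
  have h0 (x : Fin n → ℝ) : FDP θ (neverReject n) x = 0 := by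
    simp [FDP, Procedure.rej, neverReject]
  rw [risk, FDR]
  simp only [h0, integral_zero, zero_add]
  exact (integral_mono (integrable_FNP hζ θ _) (integrable_const 1) (FNP_le_one θ _)).trans_eq
    (by simp)

/-- The indicator of `a ≤ |y|`. -/
def exceeds (a y : ℝ) : ℝ := if a ≤ |y| then 1 else 0

lemma exceeds_eq_indicator (a : ℝ) : exceeds a = {y | a ≤ |y|}.indicator 1 := by
  ext y
  simp [exceeds, Set.indicator]

lemma measurableSet_le_abs (a : ℝ) : MeasurableSet {y : ℝ | a ≤ |y|} :=
  measurableSet_le measurable_const (by fun_prop)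

lemma measurable_exceeds (a : ℝ) : Measurable (exceeds a) :=
  exceeds_eq_indicator a ▸ measurable_one.indicator (measurableSet_le_abs a)

lemma exceeds_nonneg (a y : ℝ) : 0 ≤ exceeds a y := by
  unfold exceeds; split_ifs <;> norm_num

lemma exceeds_le_one (a y : ℝ) : exceeds a y ≤ 1 := by
  unfold exceeds; split_ifs <;> norm_num

lemma integral_exceeds_zero_le (hζ : 0 < ζ) (a : ℝ) :
    ∫ y, exceeds a y ∂(shifted ζ 0) ≤ 2 * tail ζ a := by
  have := isProbabilityMeasure_subbotin hζ
  rw [shifted_zero, exceeds_eq_indicator, integral_indicator_one (measurableSet_le_abs a)]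
  have h : {y : ℝ | a ≤ |y|} ⊆ Set.Ici a ∪ Set.Iic (-a) := by
    intro y hy
    rcases le_abs.1 (show a ≤ |y| from hy) with h | h
    · exact Or.inl h
    · exact Or.inr (le_neg_of_le_neg h)
  have := (measureReal_mono h (by simp)).trans
    (measureReal_union_le (μ := subbotin ζ) (Set.Ici a) (Set.Iic (-a)))
  rw [← tail_eq_Ici hζ, ← tail_eq_Iic hζ] at this
  linarith

/-- A miss forces the noise past b in the direction opposite to t; symmetry treats both signs alike.
-/
lemma one_sub_tail_le_integral_exceeds (hζ : 0 < ζ) {a b t : ℝ} (ht : a + b ≤ |t|) :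
    1 - tail ζ b ≤ ∫ y, exceeds a y ∂(shifted ζ t) := by
  have := isProbabilityMeasure_subbotin hζ
  have := isProbabilityMeasure_shifted hζ t
  rw [exceeds_eq_indicator, integral_indicator_one (measurableSet_le_abs a), sub_le_comm,
    ← probReal_compl_eq_one_sub (measurableSet_le_abs a), shifted,
    map_measureReal_apply (by fun_prop) (measurableSet_le_abs a).compl]
  rcases le_or_gt 0 t with h | h
  · rw [abs_of_nonneg h] at ht
    rw [tail_eq_Iic hζ]
    refine measureReal_mono (fun x hx => ?_) (by simp)
    have := (abs_lt.1 (not_le.1 (show ¬ a ≤ |t + x| from hx))).2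
    simp only [Set.mem_Iic]
    linarith
  · rw [abs_of_neg h] at ht
    rw [tail_eq_Ici hζ]
    refine measureReal_mono (fun x hx => ?_) (by simp)
    have := (abs_lt.1 (not_le.1 (show ¬ a ≤ |t + x| from hx))).1
    simp only [Set.mem_Ici]
    linarith

/-- The procedure rejecting the hypotheses with `a ≤ |X_i|`. -/
def thresholdProcedure (n : ℕ) (a : ℝ) : Procedure n :=
  ⟨fun x i => decide (a ≤ |x i|), measurable_pi_lambda _ fun i => measurable_to_bool <| by
    simpa [Set.preimage] using
      measurableSet_le measurable_const ((measurable_pi_apply i).abs :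
        Measurable fun x : Fin n → ℝ => |x i|)⟩

lemma thresholdProcedure_rej (a : ℝ) (x : Fin n → ℝ) (i : Fin n) :
    (thresholdProcedure n a).rej x i = exceeds a (x i) := by
  simp [Procedure.rej, thresholdProcedure, exceeds]

/-- The condition on b makes the s prescribed coordinates nonzero, and sparsity leaves no room for
others. -/
lemma exists_enumeratesSupport {b : Fin s → ℝ} (hb : ∀ j, -oracleThreshold ζ n s < b j)
    {θ : Fin n → ℝ} (hθ : θ ∈ signalClass ζ n b) :
    ∃ w, EnumeratesSupport θ w ∧ ∀ j, oracleThreshold ζ n s + b j ≤ |θ (w j)| := by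
  obtain ⟨hcard, w, hw, hwb⟩ := hθ
  refine ⟨w, ⟨hw, fun i => ?_⟩, hwb⟩
  have h1 (j : Fin s) : θ (w j) ≠ 0 := fun h => by
    have h2 := hwb j
    rw [h, abs_zero] at h2
    linarith [hb j]
  have h2 : Set.range w = {i | θ i ≠ 0} := by
    refine Set.eq_of_subset_of_ncard_le (Set.range_subset_iff.2 h1) (le_trans hcard ?_)
      (Set.toFinite _)
    rw [← Set.image_univ, Set.ncard_image_of_injective _ hw]
    simp
  exact (Set.ext_iff.1 h2 i).symm

/-- If T ≥ μ/2, the denominator is at least μ/2; otherwise the ratio is at most 1, which the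
Chebyshev term exceeds. -/
lemma div_max_le {V T μ : ℝ} (hV : 0 ≤ V) (hT : 0 ≤ T) (hμ : 0 < μ) :
    V / max 1 (V + T) ≤ 2 / μ * V + 4 / μ ^ 2 * (T - μ) ^ 2 := by
  have h0 : 0 ≤ 4 / μ ^ 2 * (T - μ) ^ 2 := by positivity
  rcases le_or_gt (μ / 2) T with h | h
  · have h1 : V / max 1 (V + T) ≤ V / (μ / 2) :=
      div_le_div_of_nonneg_left hV (by positivity) (le_max_of_le_right (by linarith))
    have h2 : V / (μ / 2) = 2 / μ * V := by field_simp
    linarith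
  · have h1 : V / max 1 (V + T) ≤ 1 :=
      div_le_one_of_le₀ (le_max_of_le_right (by linarith)) (by positivity)
    have h2 : 1 ≤ 4 / μ ^ 2 * (T - μ) ^ 2 := by
      rw [div_mul_eq_mul_div, one_le_div (by positivity)]
      nlinarith
    have : 0 ≤ 2 / μ * V := by positivity
    linarith

/-- Apply `div_max_le` with V the false and T the true rejections: EV ≤ 2n·`tail ζ a`, Var T ≤ μ and
μ ≥ s(1 - `avgTail ζ b`). -/
lemma risk_thresholdProcedure_le (hζ : 0 < ζ) (hs : 1 ≤ s) {b : Fin s → ℝ}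
    (hb : ∀ j, -oracleThreshold ζ n s < b j) (hΛ : avgTail ζ b < 1) {θ : Fin n → ℝ}
    (hθ : θ ∈ signalClass ζ n b) :
    risk ζ θ (thresholdProcedure n (oracleThreshold ζ n s))
      ≤ avgTail ζ b
        + 4 * ((n / s : ℝ) * tail ζ (oracleThreshold ζ n s) + 1 / s) / (1 - avgTail ζ b) := by
  classical
  obtain ⟨w, hw, hwb⟩ := exists_enumeratesSupport hb hθ
  have (i : Fin n) := isProbabilityMeasure_shifted hζ (θ i)
  have := isProbabilityMeasure_law hζ θ
  set a := oracleThreshold ζ n s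
  set φ := thresholdProcedure n a
  have hs' : (0 : ℝ) < s := by exact_mod_cast hs
  have hX := measurable_exceeds a
  have hXi (i : Fin n) : Integrable (fun x : Fin n → ℝ => exceeds a (x i)) (law ζ θ) :=
    integrable_law_of_bound hζ θ (by fun_prop) (C := 1) fun x => by
      rw [abs_of_nonneg (exceeds_nonneg _ _)]; exact exceeds_le_one _ _
  set μ := ∑ j, ∫ y, exceeds a y ∂(shifted ζ (θ (w j))) with hμ
  have hμ_ge : s * (1 - avgTail ζ b) ≤ μ := by
    have h1 : s * (1 - avgTail ζ b) = ∑ j, (1 - tail ζ (b j)) := by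
      rw [avgTail, Finset.sum_sub_distrib]
      simp only [Finset.sum_const, Finset.card_univ, Fintype.card_fin, nsmul_eq_mul]
      field_simp
    rw [h1]
    exact Finset.sum_le_sum fun j _ => one_sub_tail_le_integral_exceeds hζ (hwb j)
  have hμ0 : 0 < μ := lt_of_lt_of_le (mul_pos hs' (by linarith)) hμ_ge
  have hFNR : FNR ζ θ φ ≤ avgTail ζ b := by
    have h1 : FNR ζ θ φ = 1 - μ / s := by
      rw [FNR]
      simp only [hw.FNP_eq hs, φ, thresholdProcedure_rej, Finset.sum_sub_distrib, sub_div]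
      rw [integral_sub (integrable_const _)
        ((integrable_finsetSum _ fun j _ => hXi (w j)).div_const _), integral_div,
        integral_div, integral_finsetSum _ fun j _ => hXi (w j), hμ]
      simp only [integral_law_comp_eval hζ θ _ hX]
      simp [hs'.ne']
    have h2 : 1 - avgTail ζ b ≤ μ / s := by
      rw [le_div_iff₀ hs']
      linarith
    linarith
  have hVi (i : Fin n) : Integrable
      (fun x : Fin n → ℝ => if θ i = 0 then exceeds a (x i) else 0) (law ζ θ) := by
    split_ifs
    exacts [hXi i, integrable_zero _ _ _]
  have hV : ∫ x, ∑ i, (if θ i = 0 then exceeds a (x i) else 0) ∂(law ζ θ)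
      ≤ n * (2 * tail ζ a) := by
    rw [integral_finsetSum _ fun i _ => hVi i]
    refine (Finset.sum_le_card_nsmul _ _ (2 * tail ζ a) fun i _ => ?_).trans_eq (by simp)
    split_ifs with h
    · rw [integral_law_comp_eval hζ θ i hX, h]
      exact integral_exceeds_zero_le hζ a
    · rw [integral_zero]
      linarith [tail_nonneg (ζ := ζ) a]
  have hT : ∫ x, (∑ j, exceeds a (x (w j)) - μ) ^ 2 ∂(law ζ θ) ≤ μ := by
    have h := integral_sq_sum_sub_le (μ := fun i => shifted ζ (θ i)) (fun _ => hX)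
      (fun _ => exceeds_nonneg a) (fun _ => exceeds_le_one a) (Finset.univ.image w)
    rw [← law_eq_pi hζ] at h
    simpa only [Finset.sum_image hw.injective.injOn, one_mul] using h
  have hTi : Integrable (fun x : Fin n → ℝ => (∑ j, exceeds a (x (w j)) - μ) ^ 2)
      (law ζ θ) := by
    refine integrable_law_of_bound hζ θ (by fun_prop) (C := (s + μ) ^ 2) fun x => ?_
    have h1 : 0 ≤ ∑ j, exceeds a (x (w j)) := Finset.sum_nonneg fun j _ => exceeds_nonneg _ _
    have h2 : ∑ j, exceeds a (x (w j)) ≤ s :=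
      (Finset.sum_le_card_nsmul _ _ 1 fun j _ => exceeds_le_one _ _).trans_eq (by simp)
    rw [abs_of_nonneg (sq_nonneg _)]
    exact sq_le_sq' (by linarith) (by linarith)
  have hFDR : FDR ζ θ φ ≤ 2 / μ * (n * (2 * tail ζ a)) + 4 / μ ^ 2 * μ := by
    have hVs := integrable_finsetSum Finset.univ fun i _ => hVi i
    calc FDR ζ θ φ
        ≤ ∫ x, (2 / μ * ∑ i, (if θ i = 0 then exceeds a (x i) else 0)
            + 4 / μ ^ 2 * (∑ j, exceeds a (x (w j)) - μ) ^ 2) ∂(law ζ θ) := by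
          refine integral_mono (integrable_FDP hζ θ φ)
            ((hVs.const_mul _).add (hTi.const_mul _)) fun x => ?_
          simp only [FDP, hw.sum_rej_eq]
          simp only [φ, thresholdProcedure_rej]
          refine div_max_le (Finset.sum_nonneg fun i _ => ?_)
            (Finset.sum_nonneg fun j _ => exceeds_nonneg _ _) hμ0
          split_ifs
          exacts [exceeds_nonneg _ _, le_rfl]
      _ = 2 / μ * ∫ x, ∑ i, (if θ i = 0 then exceeds a (x i) else 0) ∂(law ζ θ)
            + 4 / μ ^ 2 * ∫ x, (∑ j, exceeds a (x (w j)) - μ) ^ 2 ∂(law ζ θ) := by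
          rw [integral_add (hVs.const_mul _) (hTi.const_mul _), integral_const_mul,
            integral_const_mul]
      _ ≤ _ := by gcongr
  have hend : 2 / μ * (n * (2 * tail ζ a)) + 4 / μ ^ 2 * μ
      ≤ 4 * ((n / s : ℝ) * tail ζ a + 1 / s) / (1 - avgTail ζ b) := by
    have h1 : 2 / μ * (n * (2 * tail ζ a)) + 4 / μ ^ 2 * μ = 4 * (n * tail ζ a + 1) / μ := by
      field_simp
      ring
    have h2 : 4 * ((n / s : ℝ) * tail ζ a + 1 / s) / (1 - avgTail ζ b)
        = 4 * (n * tail ζ a + 1) / (s * (1 - avgTail ζ b)) := by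
      field_simp
    rw [h1, h2]
    have := tail_nonneg (ζ := ζ) a
    exact div_le_div_of_nonneg_left (by positivity) (mul_pos hs' (by linarith)) hμ_ge
  rw [risk]
  linarith

end UpperBound

/-! ### Limits of the error terms; ζ > 1 enters through a^{ζ-1} → ∞. -/

section Asymptotics

variable {ζ : ℝ}

lemma exp_oracleThreshold (hζ : 0 < ζ) {n s : ℕ} (h : 1 ≤ (n : ℝ) / s) :
    Real.exp (oracleThreshold ζ n s ^ ζ / ζ) = n / s := by
  rw [oracleThreshold, one_div, Real.rpow_inv_rpow (mul_nonneg hζ.le (Real.log_nonneg h)) hζ.ne',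
    mul_div_cancel_left₀ _ hζ.ne', Real.exp_log (by linarith)]

lemma tendsto_oracleThreshold (hζ : 0 < ζ) {s : ℕ → ℕ}
    (hns : Tendsto (fun n : ℕ => (n : ℝ) / (s n : ℝ)) atTop atTop) :
    Tendsto (fun n => oracleThreshold ζ n (s n)) atTop atTop :=
  (tendsto_rpow_atTop (one_div_pos.2 hζ)).comp
    ((Real.tendsto_log_atTop.comp hns).const_mul_atTop hζ)

lemma tendsto_mul_tail_oracleThreshold (hζ : 1 < ζ) {s : ℕ → ℕ}
    (hns : Tendsto (fun n : ℕ => (n : ℝ) / (s n : ℝ)) atTop atTop) :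
    Tendsto (fun n : ℕ => (n : ℝ) / s n * tail ζ (oracleThreshold ζ n (s n))) atTop (𝓝 0) := by
  have h0 : 0 < ζ := by linarith
  have ha := tendsto_oracleThreshold h0 hns
  have hlim : Tendsto (fun n => (subbotinConst ζ)⁻¹ * (ζ / oracleThreshold ζ n (s n) ^ (ζ - 1)))
      atTop (𝓝 0) := by
    simpa using (((tendsto_rpow_atTop (sub_pos.2 hζ)).comp ha).const_div_atTop ζ).const_mul
      (subbotinConst ζ)⁻¹
  refine tendsto_of_tendsto_of_tendsto_of_le_of_le' tendsto_const_nhds hlim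
    (.of_forall fun n => mul_nonneg (by positivity) (tail_nonneg _)) ?_
  filter_upwards [ha.eventually_gt_atTop 0, hns.eventually_ge_atTop 1] with n hn h1
  refine (mul_le_mul_of_nonneg_left (tail_le hζ hn) (by positivity)).trans_eq ?_
  rw [Real.exp_neg, exp_oracleThreshold h0 h1]
  have : (n : ℝ) / s n ≠ 0 := by positivity
  generalize (n : ℝ) / s n = r at *
  field_simp

/-- Lowering a by δ divides e^{a^ζ/ζ} = n/s by at least e^{δ a^{ζ-1}/ζ}, which diverges. -/
lemma tendsto_exp_sub_div (hζ : 1 < ζ) {s : ℕ → ℕ}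
    (hns : Tendsto (fun n : ℕ => (n : ℝ) / (s n : ℝ)) atTop atTop) {δ : ℝ} (hδ : 0 < δ) :
    Tendsto (fun n : ℕ => Real.exp ((oracleThreshold ζ n (s n) - δ) ^ ζ / ζ)
      / (((n / s n : ℕ) : ℝ) - 1)) atTop (𝓝 0) := by
  have h0 : 0 < ζ := by linarith
  have ha := tendsto_oracleThreshold h0 hns
  have hlim : Tendsto
      (fun n => 2 * Real.exp (-(δ / ζ * oracleThreshold ζ n (s n) ^ (ζ - 1)))) atTop (𝓝 0) := by
    simpa using (Real.tendsto_exp_neg_atTop_nhds_zero.comp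
      (((tendsto_rpow_atTop (sub_pos.2 hζ)).comp ha).const_mul_atTop (div_pos hδ h0))).const_mul 2
  -- Natural division loses less than 1, so n/s ≥ 4 absorbs the total loss of 2 into a factor 1/2.
  have hfloor : ∀ᶠ n : ℕ in atTop, (n : ℝ) / s n / 2 ≤ ((n / s n : ℕ) : ℝ) - 1 := by
    filter_upwards [hns.eventually_ge_atTop 4] with n hn
    have h := Nat.lt_floor_add_one ((n : ℝ) / s n)
    rw [Nat.floor_div_eq_div] at h
    linarith
  refine tendsto_of_tendsto_of_tendsto_of_le_of_le' tendsto_const_nhds hlim ?_ ?_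
  · filter_upwards [hfloor] with n hn
    have : (0 : ℝ) ≤ (n : ℝ) / s n := by positivity
    exact div_nonneg (Real.exp_pos _).le (by linarith)
  · filter_upwards [hfloor, ha.eventually_gt_atTop δ, hns.eventually_ge_atTop 1] with n hn hd h1
    have hpos : (0 : ℝ) < (n : ℝ) / s n := by linarith
    refine (div_le_div_of_nonneg_left (Real.exp_pos _).le (by positivity) hn).trans ?_
    rw [← exp_oracleThreshold h0 h1]
    set a := oracleThreshold ζ n (s n)
    -- Bound one factor: (a - δ)^{ζ-1} ≤ a^{ζ-1}.
    have hT : (a - δ) ^ ζ ≤ a ^ ζ - δ * a ^ (ζ - 1) := by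
      rw [rpow_self_eq (sub_pos.2 hd), rpow_self_eq (hδ.trans hd), ← sub_mul]
      exact mul_le_mul_of_nonneg_left
        (Real.rpow_le_rpow (by linarith) (by linarith) (by linarith)) (by linarith)
    rw [div_div_eq_mul_div, mul_comm, mul_div_assoc, ← Real.exp_sub]
    refine mul_le_mul_of_nonneg_left (Real.exp_le_exp.2 ?_) (by norm_num)
    rw [← sub_div, div_mul_eq_mul_div, ← neg_div]
    gcongr
    linarith

end Asymptotics
end SparseTesting

end

/-! ### Assembly of the two bounds. -/

open SparseTesting in
theorem mainTheorem1 (ζ : ℝ) (hζ : 1 < ζ) (s : ℕ → ℕ)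
    (hs : Tendsto s atTop atTop)
    (hns : Tendsto (fun n : ℕ => (n : ℝ) / (s n : ℝ)) atTop atTop)
    (b : ∀ n : ℕ, Fin (s n) → ℝ)
    (hb : ∀ᶠ n : ℕ in atTop, ∀ j, -SparseTesting.oracleThreshold ζ n (s n) < b n j)
    (Λ : ℝ)
    (hΛ : Tendsto (fun n : ℕ => SparseTesting.avgTail ζ (b n)) atTop (𝓝 Λ)) :
    Tendsto (fun n : ℕ => SparseTesting.minimaxRisk ζ (SparseTesting.signalClass ζ n (b n)))
      atTop (𝓝 Λ) := by
  have h0 : 0 < ζ := by linarith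
  have ha := tendsto_oracleThreshold h0 hns
  have hs1 := hs.eventually_ge_atTop 1
  have hdiv : ∀ᶠ n : ℕ in atTop, 2 ≤ n / s n := by
    filter_upwards [hns.eventually_ge_atTop 2] with n hn
    rw [← Nat.floor_div_eq_div (K := ℝ)]
    exact Nat.le_floor (by exact_mod_cast hn)
  have hne : ∀ᶠ n : ℕ in atTop, (signalClass ζ n (b n)).Nonempty := by
    filter_upwards [hb, hdiv, hs1] with n hbn hd h1
    refine signalClass_nonempty ?_ hbn
    have := Nat.div_mul_le_self n (s n)
    nlinarith
  refine tendsto_order.2 ⟨fun l hl => ?_, fun u hu => ?_⟩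
  · set K := (subbotinConst ζ)⁻¹
    have hK : 0 < K := inv_pos.2 (subbotinConst_pos h0)
    -- The weight c and the shift δ each use at most a third of Λ - l, leaving a positive margin for
    -- the vanishing terms.
    obtain ⟨c, hc, hc1, hcl⟩ : ∃ c : ℝ, 0 < c ∧ c ≤ 1 ∧ c ≤ (Λ - l) / 3 :=
      ⟨min 1 ((Λ - l) / 3), lt_min one_pos (by linarith), min_le_left _ _, min_le_right _ _⟩
    obtain ⟨δ, hδ, hδl⟩ : ∃ δ : ℝ, 0 < δ ∧ δ * K = (Λ - l) / 3 :=
      ⟨(Λ - l) / 3 / K, div_pos (by linarith) hK, div_mul_cancel₀ _ hK.ne'⟩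
    have htail : Tendsto (fun n => tail ζ (oracleThreshold ζ n (s n) - δ)) atTop (𝓝 0) :=
      tendsto_tail.comp (tendsto_atTop_add_const_right _ (-δ) ha)
    have hlim := (((hΛ.sub_const (δ * K)).sub htail).sub
      ((tendsto_exp_sub_div hζ hns hδ).const_mul (4 + 2 / c))).sub_const c
    filter_upwards [hlim.eventually_const_lt (u := l) (by linarith), hb, hdiv, hs1]
      with n hn hbn hd h1
    exact hn.trans_le
      (minimaxRisk_ge h0 h1 hd (Nat.mul_div_le n (s n)) hbn hδ.le hc hc1)
  -- The thresholding bound divides by 1 - `avgTail`, so Λ ≥ 1 is handled by never rejecting.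
  · rcases le_or_gt 1 Λ with h1 | h1
    · filter_upwards [hne] with n hn
      exact (minimaxRisk_le_one h0 hn).trans_lt (h1.trans_lt hu)
    · have hinv : Tendsto (fun n => 1 / (s n : ℝ)) atTop (𝓝 0) :=
        (tendsto_natCast_atTop_atTop.comp hs).const_div_atTop 1
      have hlim := hΛ.add ((((tendsto_mul_tail_oracleThreshold hζ hns).add hinv).const_mul 4).div
        (hΛ.const_sub 1) (by linarith))
      filter_upwards [hlim.eventually_lt_const (u := u) (by simpa using hu), hne, hb, hs1,
        hΛ.eventually_lt_const h1] with n hn hnen hbn h1n hΛn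
      exact (minimaxRisk_le hnen _ fun θ hθ =>
        risk_thresholdProcedure_le h0 h1n hbn hΛn hθ).trans_lt hn
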